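/- All graphs are simple, and $\chi$ denotes the chromatic number. The categorical product $G\times H$ of graphs $G$ and $H$ has vertex set $V(G)\times V(H)$, with $(x,y)$ adjacent to $(x',y')$ if and only if $xx'\in E(G)$ and $yy'\in E(H)$. The Poljak–Rödl function $f:\mathbb N\to\mathbb N$ is $$f(n)=\min\{\chi(G\times H) : G,H \text{ finite graphs with } \chi(G)\ge n \text{ and } \chi(H)\ge n\}.$$ The Kneser graph $K(m,n)$ has as vertices the $n$-element subsets of $\{1,\dots,m\}$, two of them being adjacent if and only if they are disjoint. For $k\ge 1$, the $k$-th multichromatic number $\chi_k(H)$ of a graph $H$ is the least integer $m$ such that $H$ admits a homomorphism to $K(m,k)$. Stahl's conjecture on the multichromatic numbers of Kneser graphs is the assertion that for all integers $m,n,a,b,k$ with $k=an+b$, $a\ge 1$, $1\le b\le n-1$ and $m\ge 2n$, $$\chi_k(K(m,n))=\chi_{an}(K(m,n))+\chi_b(K(m,n))=(a+1)m-2(n-b).$$ Then: (i) $\lim_{n\to\infty}\,(n-f(n))=\infty$. (ii) If Stahl's conjecture holds, then $\limsup_{n\to\infty} f(n)/n\le 1/2$. -/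

import Mathlib

/-- The categorical product `G × H`: `(x, y)` and `(x', y')` are adjacent iff
`x x'` is an edge of `G` and `y y'` is an edge of `H`. -/
def catProd {V W : Type*} (G : SimpleGraph V) (H : SimpleGraph W) : SimpleGraph (V × W) where
  Adj p q := G.Adj p.1 q.1 ∧ H.Adj p.2 q.2
  symm := ⟨fun _ _ h => ⟨h.1.symm, h.2.symm⟩⟩
  loopless := ⟨fun _ h => G.irrefl h.1⟩

/-- The set of the chromatic numbers of all products `G × H` of two finite graphs `G`, `H`
with `χ(G) ≥ n` and `χ(H) ≥ n`. -/
def productChromaticNumbers (n : ℕ) : Set ℕ :=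
  {k | ∃ (V W : Type) (_ : Finite V) (_ : Finite W) (G : SimpleGraph V) (H : SimpleGraph W),
    (n : ℕ∞) ≤ G.chromaticNumber ∧ (n : ℕ∞) ≤ H.chromaticNumber ∧
      (catProd G H).chromaticNumber = (k : ℕ∞)}

/-- The Poljak–Rödl function `f(n) = min {χ(G × H) : χ(G), χ(H) ≥ n}`, over finite graphs. -/
noncomputable def poljakRodl (n : ℕ) : ℕ := sInf (productChromaticNumbers n)

/-- The set whose minimum is taken is never empty, so `poljakRodl n` is a genuine minimum. -/
theorem productChromaticNumbers_nonempty (n : ℕ) : (productChromaticNumbers n).Nonempty := by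
  have h : (catProd (⊤ : SimpleGraph (Fin n)) (⊤ : SimpleGraph (Fin n))).chromaticNumber ≠ ⊤ :=
    SimpleGraph.chromaticNumber_ne_top_iff_exists.2
      ⟨_, SimpleGraph.colorable_chromaticNumber_of_fintype _⟩
  obtain ⟨k, hk⟩ := ENat.ne_top_iff_exists.1 h
  exact ⟨k, Fin n, Fin n, inferInstance, inferInstance, ⊤, ⊤, by simp, by simp, hk.symm⟩

theorem poljakRodl_mem (n : ℕ) : poljakRodl n ∈ productChromaticNumbers n :=
  Nat.sInf_mem (productChromaticNumbers_nonempty n)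

/-- The Kneser graph `K(m, n)`: the vertices are the `n`-subsets of an `m`-set, and two of them
are adjacent iff they are disjoint. (For `n ≥ 1` the condition `s ≠ t` is automatic.) -/
def kneserGraph (m n : ℕ) : SimpleGraph {s : Finset (Fin m) // s.card = n} where
  Adj s t := s ≠ t ∧ Disjoint s.1 t.1
  symm := ⟨fun _ _ h => ⟨h.1.symm, h.2.symm⟩⟩
  loopless := ⟨fun _ h => h.1 rfl⟩

/-- The `k`-th multichromatic number `χ_k(H)` (for `k ≥ 1`): the least `m` such that `H` admits a
homomorphism to `K(m, k)`, and `⊤` if there is no such `m`. -/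
noncomputable def multichromaticNumber {V : Type*} (H : SimpleGraph V) (k : ℕ) : ℕ∞ :=
  ⨅ m ∈ {m : ℕ | Nonempty (H →g kneserGraph m k)}, (m : ℕ∞)

/-- Stahl's conjecture on the multichromatic numbers of Kneser graphs: if `k = a n + b` with
`a ≥ 1` and `1 ≤ b ≤ n - 1`, then for `m ≥ 2 n`,
`χ_k(K(m, n)) = χ_{an}(K(m, n)) + χ_b(K(m, n)) = (a + 1) m - 2 (n - b)`.
The subtractions do not truncate, since `b < n` and `2 n ≤ m`. -/
def StahlConjecture : Prop :=
  ∀ m n a b k : ℕ, k = a * n + b → 1 ≤ a → 1 ≤ b → b ≤ n - 1 → 2 * n ≤ m →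
    multichromaticNumber (kneserGraph m n) k =
        multichromaticNumber (kneserGraph m n) (a * n) +
          multichromaticNumber (kneserGraph m n) b ∧
      multichromaticNumber (kneserGraph m n) (a * n) +
          multichromaticNumber (kneserGraph m n) b =
        (((a + 1) * m - 2 * (n - b) : ℕ) : ℕ∞)

/-- `G` has no closed walk of length five. -/
def NoClosedFiveWalk {V : Type*} (G : SimpleGraph V) : Prop :=
  ∀ a b c d e, G.Adj a b → G.Adj b c → G.Adj c d → G.Adj d e → ¬ G.Adj e a

theorem NoClosedFiveWalk.triangleFree {V : Type*} {G : SimpleGraph V} (h : NoClosedFiveWalk G)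
    {a b c : V} (hab : G.Adj a b) (hbc : G.Adj b c) : ¬ G.Adj c a :=
  fun hca => h a b c a b hab hbc hca hab hab.symm

/-! ### Exponential graphs of clique blow-ups -/

/-- The lexicographic product `G[K_q]`: each vertex of `G` is replaced by a clique of size `q`. -/
def cliqueBlowup {V : Type*} (G : SimpleGraph V) (q : ℕ) : SimpleGraph (V × Fin q) where
  Adj a b := G.Adj a.1 b.1 ∨ (a.1 = b.1 ∧ a.2 ≠ b.2)
  symm := ⟨fun _ _ h => h.imp (fun h => h.symm) fun h => ⟨h.1.symm, h.2.symm⟩⟩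
  loopless := ⟨fun _ h => h.elim G.irrefl fun h => h.2 rfl⟩

/-- The exponential graph `K_C ^ Γ`, without its loops. -/
def expGraph {W : Type*} (C : Type*) (Γ : SimpleGraph W) : SimpleGraph (W → C) where
  Adj f g := f ≠ g ∧ ∀ x y, Γ.Adj x y → f x ≠ g y
  symm := ⟨fun _ _ h => ⟨h.1.symm, fun x y hxy => (h.2 y x hxy.symm).symm⟩⟩
  loopless := ⟨fun _ h => h.1 rfl⟩

/-- A loop at `f` would be a proper colouring of `Γ`, so deleting loops loses nothing here. -/
theorem expGraph_adj_of_isEmpty {W C : Type*} {Γ : SimpleGraph W} (hΓ : IsEmpty (Γ.Coloring C))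
    {f g : W → C} (h : ∀ x y, Γ.Adj x y → f x ≠ g y) : (expGraph C Γ).Adj f g := by
  refine ⟨?_, h⟩
  rintro rfl
  exact hΓ.false (SimpleGraph.Coloring.mk f fun {x y} hxy => h x y hxy)

/-- A function avoiding all conflicts, when each value forbids few values elsewhere. -/
theorem exists_conflictFree {V C : Type*} [Fintype V] [Fintype C]
    (S : V → C → Finset C) (k : ℕ) (hS : ∀ v b, (S v b).card ≤ k)
    (hC : Fintype.card V * Fintype.card V * k < Fintype.card C) :
    ∃ φ : V → C, ∀ u v, u ≠ v → φ u ∉ S v (φ v) := by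
  classical
  by_contra! hcon
  set c := Fintype.card C
  set p := Fintype.card V
  -- Union bound over ordered pairs `(u, v)`: resampling `φ u` leaves `S v (φ v)` unchanged, so a
  -- pair is bad for at most a fraction `k / c` of all maps.
  let bad : V × V → Finset (V → C) := fun z =>
    Finset.univ.filter fun φ => z.1 ≠ z.2 ∧ φ z.1 ∈ S z.2 (φ z.2)
  have hbad : ∀ z, (bad z).card * c ≤ Fintype.card (V → C) * k := by
    rintro ⟨u, v⟩
    have h1 : (bad (u, v) ×ˢ (Finset.univ : Finset C)).card ≤
        ((Finset.univ : Finset (V → C)).sigma fun φ => S v (φ v)).card := by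
      refine Finset.card_le_card_of_injOn
        (fun a => ⟨Function.update a.1 u a.2, a.1 u⟩) ?_ ?_
      · rintro ⟨φ, b⟩ h
        have h' : u ≠ v ∧ φ u ∈ S v (φ v) := by simpa [bad] using h
        simp [Function.update_of_ne h'.1.symm, h'.2]
      · rintro ⟨φ, b⟩ - ⟨φ', b'⟩ - h
        simp only [Sigma.mk.injEq, heq_eq_eq] at h
        have hb : b = b' := by simpa using congrFun h.1 u
        refine Prod.ext (funext fun x => ?_) hb
        by_cases hx : x = u
        · rw [hx]; exact h.2
        · simpa [hx] using congrFun h.1 x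
    rw [Finset.card_product, Finset.card_sigma, Finset.card_univ] at h1
    refine h1.trans ((Finset.sum_le_card_nsmul _ _ k fun φ _ => hS v (φ v)).trans ?_)
    simp
  have hcover : (Finset.univ : Finset (V → C)) ⊆ Finset.univ.biUnion bad := by
    intro φ _
    obtain ⟨u, v, huv, h⟩ := hcon φ
    exact Finset.mem_biUnion.2 ⟨(u, v), Finset.mem_univ _, by simp [bad, huv, h]⟩
  have h2 : Fintype.card (V → C) * c ≤ Fintype.card (V → C) * (p * p * k) := by
    calc Fintype.card (V → C) * c ≤ (∑ z, (bad z).card) * c :=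
          Nat.mul_le_mul_right _ ((Finset.card_le_card hcover).trans Finset.card_biUnion_le)
      _ = ∑ z, (bad z).card * c := Finset.sum_mul ..
      _ ≤ ∑ _z : V × V, Fintype.card (V → C) * k := Finset.sum_le_sum fun z _ => hbad z
      _ = Fintype.card (V → C) * (p * p * k) := by
          simp [Fintype.card_prod, p, Finset.card_univ]; ring
  have : Nonempty C := Fintype.card_pos_iff.1 (by omega)
  exact absurd (Nat.le_of_mul_le_mul_left h2 Fintype.card_pos) (by omega)

section Exponential

variable {V C : Type*} {G : SimpleGraph V} {q : ℕ}

theorem expGraph_adj_comp_fst (hΓ : IsEmpty ((cliqueBlowup G q).Coloring C))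
    {φ : V → C} {μ : V × Fin q → C} (h : ∀ x y i, (x = y ∨ G.Adj x y) → φ x ≠ μ (y, i)) :
    (expGraph C (cliqueBlowup G q)).Adj (φ ∘ Prod.fst) μ :=
  expGraph_adj_of_isEmpty hΓ fun x y hxy => h x.1 y.1 y.2 (hxy.elim Or.inr fun h => Or.inl h.1)

/-- A proper colouring of the exponential graph by `C` itself can be normalised so that each
constant map receives its own value. -/
theorem exists_coloring_const [Finite C] (hΓ : IsEmpty ((cliqueBlowup G q).Coloring C))
    (Ψ : (expGraph C (cliqueBlowup G q)).Coloring C) :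
    ∃ Ψ : (expGraph C (cliqueBlowup G q)).Coloring C, ∀ b, Ψ (fun _ => b) = b := by
  have hinj : Function.Injective fun b : C => Ψ (fun _ => b) := by
    intro a b hab
    by_contra hne
    exact Ψ.valid (expGraph_adj_of_isEmpty hΓ (f := fun _ => a) (g := fun _ => b)
      fun _ _ _ => hne) hab
  let e := Equiv.ofBijective _ (Finite.injective_iff_bijective.1 hinj)
  refine ⟨SimpleGraph.Coloring.mk (fun f => e.symm (Ψ f)) fun {f g} hfg h => Ψ.valid hfg
    (e.symm.injective h), fun b => ?_⟩
  exact e.symm_apply_apply b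

/-- A map omitting the value `b` is adjacent to the constant map `b`, whose colour is `b`. -/
theorem coloring_mem_range (hΓ : IsEmpty ((cliqueBlowup G q).Coloring C))
    (Ψ : (expGraph C (cliqueBlowup G q)).Coloring C) (hΨ : ∀ b, Ψ (fun _ => b) = b)
    (f : V × Fin q → C) : ∃ x, f x = Ψ f := by
  by_contra! h
  exact Ψ.valid (expGraph_adj_of_isEmpty hΓ (f := f) (g := fun _ => Ψ f) fun x _ _ => h x)
    (hΨ _).symm

/-- There is a vertex `v` and a colour `d` such that a map that is constant on the fibres and has
colour `d` must take the value `d` in the closed neighbourhood of `v`. -/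
theorem exists_robust [Fintype V] [Fintype C] (hΓ : IsEmpty ((cliqueBlowup G q).Coloring C))
    (hC : Fintype.card V ^ 3 < Fintype.card C)
    (Ψ : (expGraph C (cliqueBlowup G q)).Coloring C) (hΨ : ∀ b, Ψ (fun _ => b) = b) :
    ∃ v d, ∀ φ : V → C, Ψ (φ ∘ Prod.fst) = d → ∃ w, (v = w ∨ G.Adj v w) ∧ φ w = d := by
  classical
  by_contra! hcon
  choose ψ hψ hψv using hcon
  -- If `φ` receives the colour `φ v`, it will be adjacent to `ψ v (φ v)`, which has the same
  -- colour: at `v` because `ψ v (φ v)` avoids `φ v` on the closed neighbourhood, elsewhere by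
  -- conflict-freeness.
  obtain ⟨φ, hφ⟩ := exists_conflictFree (fun v b => Finset.univ.image (ψ v b)) (Fintype.card V)
    (fun v b => Finset.card_image_le) (by simpa [pow_succ] using hC)
  obtain ⟨⟨v, i⟩, hv⟩ := coloring_mem_range hΓ Ψ hΨ (φ ∘ Prod.fst)
  refine Ψ.valid (expGraph_adj_comp_fst hΓ (φ := φ) (μ := ψ v (φ v) ∘ Prod.fst) ?_)
    (hv.symm.trans (hψ v (φ v)).symm)
  intro x y _ hxy
  by_cases hx : x = v
  · subst hx
    exact (hψv x (φ x) y hxy).symm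
  · intro h
    exact hφ x v hx (by simp [h])

/-- The maps `μ t` are pairwise adjacent, but robustness of `(v, d)` forces their colours into a
palette `P` of at most `2q` colours, whereas at least `2q + 1` values of `t` are available. -/
theorem not_colorable_expGraph [Fintype V] [Fintype C] (hG : NoClosedFiveWalk G)
    (hΓ : IsEmpty ((cliqueBlowup G q).Coloring C))
    (hV : Fintype.card V ^ 3 < Fintype.card C) (hq : 4 * q + 2 ≤ Fintype.card C) :
    IsEmpty ((expGraph C (cliqueBlowup G q)).Coloring C) := by
  classical
  refine ⟨fun Ψ₀ => ?_⟩
  obtain ⟨Ψ, hΨ⟩ := exists_coloring_const hΓ Ψ₀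
  obtain ⟨v, d, hd⟩ := exists_robust hΓ hV Ψ hΨ
  -- Two disjoint palettes of `q` colours avoiding `d`: one for `E`, one for the neighbours of `v`.
  obtain ⟨e⟩ : Nonempty (Fin q ⊕ Fin q ↪ {c // c ≠ d}) := by
    apply Function.Embedding.nonempty_of_card_le
    rw [Fintype.card_subtype_compl]
    simp
    omega
  set π : Fin q ⊕ Fin q → C := fun z => (e z).1
  have hπ : Function.Injective π := fun a b h => e.injective (Subtype.ext h)
  have hπd : ∀ z, π z ≠ d := fun z => (e z).2
  let P : Finset C := Finset.univ.image π
  have hP : P.card ≤ 2 * q := Finset.card_image_le.trans (by simp; omega)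
  have hmem : ∀ z, π z ∈ P := fun z => Finset.mem_image_of_mem _ (Finset.mem_univ z)
  let E : V → Prop := fun x => x = v ∨ ∃ y, G.Adj v y ∧ G.Adj y x
  let μ : C → V × Fin q → C := fun t z =>
    if E z.1 then π (.inl z.2) else if G.Adj v z.1 then π (.inr z.2) else t
  -- An edge inside `E` would close a walk of length five, or a triangle, through `v`.
  have hE : ∀ x y, E x → E y → ¬ G.Adj x y := by
    rintro x y (rfl | ⟨x', h1, h2⟩) (rfl | ⟨y', h3, h4⟩) hxy
    · exact G.irrefl hxy
    · exact hG.triangleFree h3 h4 hxy.symm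
    · exact hG.triangleFree h1 h2 hxy
    · exact hG v x' x y y' h1 h2 hxy h4.symm h3.symm
  have hμadj : ∀ s t, s ∉ P → t ∉ P → s ≠ t →
      (expGraph C (cliqueBlowup G q)).Adj (μ s) (μ t) := by
    intro s t hs ht hst
    have hs' : ∀ z, π z ≠ s := fun z h => hs (h ▸ hmem z)
    have ht' : ∀ z, π z ≠ t := fun z h => ht (h ▸ hmem z)
    refine expGraph_adj_of_isEmpty hΓ ?_
    rintro ⟨x, i⟩ ⟨y, j⟩ (hxy | ⟨hxy, hij⟩)
    · have h1 := hE x y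
      have h2 : G.Adj v x → ¬ G.Adj v y := fun h h' => hG.triangleFree h hxy h'.symm
      simp only [μ]
      split_ifs with a b c d e
      · exact absurd hxy (h1 a b)
      · exact fun h => Sum.inl_ne_inr (hπ h)
      · exact ht' _
      · exact fun h => Sum.inr_ne_inl (hπ h)
      · exact absurd ‹G.Adj v y› (h2 ‹G.Adj v x›)
      · exact ht' _
      · exact (hs' _).symm
      · exact (hs' _).symm
      · exact hst
    · simp only at hxy hij
      subst hxy
      simp only [μ]
      split_ifs
      · exact fun h => hij (Sum.inl_injective (hπ h))
      · exact fun h => hij (Sum.inr_injective (hπ h))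
      · exact hst
  have hμP : ∀ t, t ∉ P → t ≠ d → Ψ (μ t) ∈ P := by
    intro t ht htd
    obtain ⟨⟨y, i⟩, hy⟩ := coloring_mem_range hΓ Ψ hΨ (μ t)
    have hcases : ∀ y i, μ t (y, i) ∈ P ∨ μ t (y, i) = t := by
      intro y i
      simp only [μ]
      split_ifs <;> simp [hmem]
    rw [← hy]
    refine (hcases y i).resolve_right fun h => ?_
    -- By robustness `φ` cannot have colour `d`, so it has colour `t`; yet it is adjacent to `μ t`,
    -- which takes values in `P` within distance two of `v` and never takes the value `d`.
    let φ : V → C := fun x => if v = x ∨ G.Adj v x then t else d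
    have hφ : Ψ (φ ∘ Prod.fst) = t := by
      obtain ⟨x, hx⟩ := coloring_mem_range hΓ Ψ hΨ (φ ∘ Prod.fst)
      by_cases hxd : Ψ (φ ∘ Prod.fst) = d
      · obtain ⟨w, hw, hwd⟩ := hd φ hxd
        simp only [φ, if_pos hw] at hwd
        exact absurd hwd htd
      · rw [← hx] at hxd ⊢
        simp only [φ, Function.comp] at hxd ⊢
        split_ifs at hxd ⊢
        · rfl
        · exact absurd rfl hxd
    refine Ψ.valid (expGraph_adj_comp_fst hΓ (φ := φ) (μ := μ t) ?_) (hφ.trans (h.symm.trans hy))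
    intro x y i hxy h'
    by_cases hx : v = x ∨ G.Adj v x
    · have : μ t (y, i) ∈ P := by
        have : E y ∨ G.Adj v y := by
          rcases hx with rfl | hx <;> rcases hxy with rfl | hxy
          · exact Or.inl (Or.inl rfl)
          · exact Or.inr hxy
          · exact Or.inr hx
          · exact Or.inl (Or.inr ⟨x, hx, hxy⟩)
        simp only [μ]
        split_ifs with h1 h2
        · exact hmem _
        · exact hmem _
        · exact absurd this (not_or.2 ⟨h1, h2⟩)
      rw [← h'] at this
      simp only [φ, if_pos hx] at this
      exact ht this
    · simp only [φ, if_neg hx] at h'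
      rcases hcases y i with h | h
      · rw [← h'] at h
        obtain ⟨z, -, hz⟩ := Finset.mem_image.1 h
        exact hπd z hz
      · exact htd (h.symm.trans h'.symm)
  have hle : (Finset.univ \ insert d P).card ≤ P.card := by
    refine Finset.card_le_card_of_injOn (fun t => Ψ (μ t)) ?_ ?_
    · intro t ht
      have : t ≠ d ∧ t ∉ P := by simpa using ht
      exact hμP t this.2 this.1
    · intro s hs t ht hst
      by_contra hne
      have hs' : s ≠ d ∧ s ∉ P := by simpa using hs
      have ht' : t ≠ d ∧ t ∉ P := by simpa using ht
      exact Ψ.valid (hμadj s t hs'.2 ht'.2 hne) hst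
  have h1 := Finset.le_card_sdiff (insert d P) (Finset.univ : Finset C)
  have h2 := Finset.card_insert_le d P
  rw [Finset.card_univ] at h1
  omega

end Exponential


/-! ### Fractional chromatic number and its certificates -/

/-- A graph together with optimal solutions of value `χ` of the linear programs for the fractional
clique and chromatic numbers, and without closed five-walks. -/
structure FractionalCertificate (χ : ℝ) where
  V : Type
  [fintypeV : Fintype V]
  G : SimpleGraph V
  noFive : NoClosedFiveWalk G
  μ : V → ℝ
  μ_nonneg : ∀ x, 0 ≤ μ x
  μ_total : ∑ x, μ x = 1
  μ_indep : ∀ A : Finset V, (∀ x ∈ A, ∀ y ∈ A, ¬ G.Adj x y) → χ * ∑ x ∈ A, μ x ≤ 1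
  ι : Type
  [fintypeι : Fintype ι]
  ν : ι → ℝ
  ν_nonneg : ∀ j, 0 ≤ ν j
  ν_total : ∑ j, ν j = 1
  J : ι → V → Prop
  J_indep : ∀ j x y, J j x → J j y → ¬ G.Adj x y
  cover : ∀ x, open Classical in 1 ≤ χ * ∑ j, if J j x then ν j else 0

namespace FractionalCertificate

attribute [instance] fintypeV fintypeι

open Classical in
theorem expansion {χ : ℝ} (Z : FractionalCertificate χ) (A B : Finset Z.V)
    (hA : ∀ x ∈ A, ∀ y ∈ A, ¬ Z.G.Adj x y) (hAB : ∀ x ∈ A, ∀ y ∈ B, ¬ Z.G.Adj x y)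
    (hd : Disjoint A B) : χ * ∑ x ∈ A, Z.μ x + ∑ x ∈ B, Z.μ x ≤ 1 := by
  -- `A ∪ (B ∩ J j)` is independent; averaging over `ν` then covers each point of `B` with mass at
  -- least `1/χ`.
  have key : ∀ j, χ * ∑ x ∈ A, Z.μ x + χ * ∑ x ∈ B with Z.J j x, Z.μ x ≤ 1 := by
    intro j
    have hdj : Disjoint A (B.filter (Z.J j)) := hd.mono_right (Finset.filter_subset _ _)
    rw [← mul_add, ← Finset.sum_union hdj]
    refine Z.μ_indep _ fun x hx y hy => ?_
    simp only [Finset.mem_union, Finset.mem_filter] at hx hy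
    rcases hx with hx | hx <;> rcases hy with hy | hy
    · exact hA x hx y hy
    · exact hAB x hx y hy.1
    · exact fun h => hAB y hy x hx.1 h.symm
    · exact Z.J_indep j x y hx.2 hy.2
  have h1 : ∑ j, Z.ν j * (χ * ∑ x ∈ A, Z.μ x + χ * ∑ x ∈ B with Z.J j x, Z.μ x) ≤ 1 := by
    rw [← Z.ν_total]
    exact Finset.sum_le_sum fun j _ => mul_le_of_le_one_right (Z.ν_nonneg j) (key j)
  have h2 : ∑ j, Z.ν j * (χ * ∑ x ∈ A, Z.μ x + χ * ∑ x ∈ B with Z.J j x, Z.μ x) =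
      χ * ∑ x ∈ A, Z.μ x + ∑ x ∈ B, Z.μ x * (χ * ∑ j, if Z.J j x then Z.ν j else 0) := by
    simp only [mul_add, Finset.sum_add_distrib, ← Finset.sum_mul, Z.ν_total, one_mul]
    congr 1
    simp only [Finset.mul_sum, Finset.sum_filter]
    rw [Finset.sum_comm]
    refine Finset.sum_congr rfl fun x _ => Finset.sum_congr rfl fun j _ => ?_
    split_ifs <;> ring
  have h3 : ∑ x ∈ B, Z.μ x ≤ ∑ x ∈ B, Z.μ x * (χ * ∑ j, if Z.J j x then Z.ν j else 0) :=
    Finset.sum_le_sum fun x _ => le_mul_of_one_le_right (Z.μ_nonneg x) (Z.cover x)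
  linarith

/-- The single edge. -/
noncomputable def edge : FractionalCertificate 2 where
  V := Bool
  G := ⊤
  noFive := by unfold NoClosedFiveWalk; simp only [SimpleGraph.top_adj]; decide
  μ _ := 1 / 2
  μ_nonneg _ := by norm_num
  μ_total := by simp
  μ_indep A hA := by
    have : (A.card : ℝ) ≤ 1 := by
      exact_mod_cast Finset.card_le_one.2 fun x hx y hy => by simpa using hA x hx y hy
    simp
    linarith
  ι := Bool
  ν _ := 1 / 2
  ν_nonneg _ := by norm_num
  ν_total := by simp
  J j x := x = j
  J_indep := by rintro j x y rfl rfl; simp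
  cover x := by cases x <;> simp

end FractionalCertificate

/-! ### Generalized Mycielskians -/

/-- The generalized Mycielskian of `G` with levels `0, 1, 2` and the apex `none`. -/
def mycielskian {V : Type*} (G : SimpleGraph V) : SimpleGraph (Option (V × Fin 3)) where
  Adj a b := match a, b with
    | none, none => False
    | none, some y => y.2 = 2
    | some x, none => x.2 = 2
    | some x, some y => G.Adj x.1 y.1 ∧
        ((x.2 = 0 ∧ y.2 = 0) ∨ (x.2 = 0 ∧ y.2 = 1) ∨ (x.2 = 1 ∧ y.2 = 0) ∨
          (x.2 = 1 ∧ y.2 = 2) ∨ (x.2 = 2 ∧ y.2 = 1))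
  symm := ⟨by
    rintro (_ | x) (_ | y) h
    · exact h
    · exact h
    · exact h
    · exact ⟨h.1.symm, by tauto⟩⟩
  loopless := ⟨by
    rintro (_ | x) h
    · exact h
    · exact G.irrefl h.1⟩

/-- A closed five-walk avoiding the apex projects to `G`. An odd closed walk through the apex must
descend to an edge in level `0` and return, which takes at least seven steps. -/
theorem NoClosedFiveWalk.mycielskian {V : Type*} {G : SimpleGraph V} (hG : NoClosedFiveWalk G) :
    NoClosedFiveWalk (mycielskian G) := by
  have key : ∀ b c d e, (_root_.mycielskian G).Adj none b → (_root_.mycielskian G).Adj b c →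
      (_root_.mycielskian G).Adj c d → (_root_.mycielskian G).Adj d e →
      ¬ (_root_.mycielskian G).Adj e none := by
    rintro (_ | ⟨b, i⟩) (_ | ⟨c, j⟩) (_ | ⟨d, k⟩) (_ | ⟨e, l⟩) h1 h2 h3 h4 h5 <;>
      simp_all [_root_.mycielskian]
  intro a b c d e h1 h2 h3 h4 h5
  rcases a with _ | a
  · exact key _ _ _ _ h1 h2 h3 h4 h5
  rcases b with _ | b
  · exact key _ _ _ _ h2 h3 h4 h5 h1
  rcases c with _ | c
  · exact key _ _ _ _ h3 h4 h5 h1 h2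
  rcases d with _ | d
  · exact key _ _ _ _ h4 h5 h1 h2 h3
  rcases e with _ | e
  · exact key _ _ _ _ h5 h1 h2 h3 h4
  exact hG _ _ _ _ _ h1.1 h2.1 h3.1 h4.1 h5.1

namespace FractionalCertificate

theorem mycielskian_weight_le {χ : ℝ} (hχ : 2 ≤ χ) (Z : FractionalCertificate χ)
    (A : Finset (Option (Z.V × Fin 3)))
    (hA : ∀ x ∈ A, ∀ y ∈ A, ¬ (mycielskian Z.G).Adj x y) :
    ∑ x ∈ A, (match x with
      | none => 1
      | some z => (χ - 1) ^ (2 - z.2.1) * χ * Z.μ z.1 : ℝ) ≤ 1 + (χ - 1) + (χ - 1) ^ 2 := by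
  classical
  let L : Fin 3 → Finset Z.V := fun i => Finset.univ.filter fun x => some (x, i) ∈ A
  have hL : ∀ i x, x ∈ L i ↔ some (x, i) ∈ A := by simp [L]
  have hsum : ∑ x ∈ A, (match x with
      | none => 1
      | some z => (χ - 1) ^ (2 - z.2.1) * χ * Z.μ z.1 : ℝ) =
      (if none ∈ A then 1 else 0) + (χ - 1) ^ 2 * χ * ∑ x ∈ L 0, Z.μ x +
        (χ - 1) * χ * ∑ x ∈ L 1, Z.μ x + χ * ∑ x ∈ L 2, Z.μ x := by
    rw [← Finset.univ_inter A, ← Finset.filter_mem_eq_inter]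
    simp only [L, Finset.sum_filter, Fintype.sum_option, Fintype.sum_prod_type, Fin.sum_univ_three,
      Finset.sum_add_distrib, Finset.mul_sum, mul_ite, mul_zero]
    simp [add_assoc]
  rw [hsum]
  have h00 : ∀ x ∈ L 0, ∀ y ∈ L 0, ¬ Z.G.Adj x y := fun x hx y hy h =>
    hA _ ((hL _ _).1 hx) _ ((hL _ _).1 hy) ⟨h, by simp⟩
  have h01 : ∀ x ∈ L 0, ∀ y ∈ L 1, ¬ Z.G.Adj x y := fun x hx y hy h =>
    hA _ ((hL _ _).1 hx) _ ((hL _ _).1 hy) ⟨h, by simp⟩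
  have h12 : ∀ x ∈ L 1, ∀ y ∈ L 2, ¬ Z.G.Adj x y := fun x hx y hy h =>
    hA _ ((hL _ _).1 hx) _ ((hL _ _).1 hy) ⟨h, by simp⟩
  have hmono : ∀ S T : Finset Z.V, S ⊆ T → ∑ x ∈ S, Z.μ x ≤ ∑ x ∈ T, Z.μ x := fun S T h =>
    Finset.sum_le_sum_of_subset_of_nonneg h fun x _ _ => Z.μ_nonneg x
  have hpos : ∀ S : Finset Z.V, 0 ≤ ∑ x ∈ S, Z.μ x := fun S =>
    Finset.sum_nonneg fun x _ => Z.μ_nonneg x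
  have hχ0 : 0 ≤ χ := by linarith
  by_cases hz : none ∈ A
  · have h2 : L 2 = ∅ := by
      ext x
      simp only [hL, Finset.notMem_empty, iff_false]
      exact fun hx => hA _ hz _ hx rfl
    have h1 := Z.expansion (L 0) (L 1 \ L 0) h00
      (fun x hx y hy => h01 x hx y (Finset.mem_sdiff.1 hy).1) Finset.disjoint_sdiff
    have h3 : ∑ x ∈ L 1, Z.μ x ≤ ∑ x ∈ L 0, Z.μ x + ∑ x ∈ L 1 \ L 0, Z.μ x := by
      rw [← Finset.sum_union Finset.disjoint_sdiff]
      exact hmono _ _ (by intro x hx; simp [hx])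
    rw [h2, if_pos hz, Finset.sum_empty]
    have h4 : ∑ x ∈ L 1, Z.μ x ≤ 1 - (χ - 1) * ∑ x ∈ L 0, Z.μ x := by linarith
    have h5 := mul_le_mul_of_nonneg_left h4 (show 0 ≤ (χ - 1) * χ by nlinarith)
    nlinarith
  · rw [if_neg hz]
    -- `A₁` consists of the vertices isolated in `L 1`. Each vertex of `Y` has a neighbour in `L 1`,
    -- hence lies in neither `L 0` nor `L 2`; this allows `expansion` for `A₁` against `Y ∪ (L 2 \
    -- A₁)` and for `L 0` against `Y`.
    let A₁ := (L 1).filter fun x => ∀ y ∈ L 1, ¬ Z.G.Adj x y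
    let Y := (L 1).filter fun x => ¬ ∀ y ∈ L 1, ¬ Z.G.Adj x y
    have hX : ∑ x ∈ L 1, Z.μ x = ∑ x ∈ A₁, Z.μ x + ∑ x ∈ Y, Z.μ x :=
      (Finset.sum_filter_add_sum_filter_not _ _ _).symm
    have hY : ∀ x ∈ Y, ∃ y ∈ L 1, Z.G.Adj x y := fun x hx => by
      simpa using (Finset.mem_filter.1 hx).2
    have hdA₁Y : Disjoint A₁ Y := Finset.disjoint_filter_filter_not _ _ _
    have hdY2 : Disjoint Y (L 2 \ A₁) := by
      rw [Finset.disjoint_left]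
      intro x hx hx2
      obtain ⟨y, hy, h⟩ := hY x hx
      exact h12 y hy x (Finset.mem_sdiff.1 hx2).1 h.symm
    have e1 := Z.expansion A₁ (Y ∪ (L 2 \ A₁))
      (fun x hx y hy => (Finset.mem_filter.1 hx).2 y (Finset.mem_filter.1 hy).1)
      (fun x hx y hy => by
        rcases Finset.mem_union.1 hy with hy | hy
        · exact (Finset.mem_filter.1 hx).2 y (Finset.mem_filter.1 hy).1
        · exact h12 x (Finset.mem_filter.1 hx).1 y (Finset.mem_sdiff.1 hy).1)
      (Finset.disjoint_union_right.2 ⟨hdA₁Y, Finset.disjoint_sdiff⟩)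
    rw [Finset.sum_union hdY2] at e1
    have e2 : ∑ x ∈ L 2, Z.μ x ≤ ∑ x ∈ A₁, Z.μ x + ∑ x ∈ L 2 \ A₁, Z.μ x := by
      rw [← Finset.sum_union Finset.disjoint_sdiff]
      exact hmono _ _ (by intro x hx; simp [hx])
    have e3 := Z.expansion (L 0) Y h00
      (fun x hx y hy => h01 x hx y (Finset.mem_filter.1 hy).1) (by
        rw [Finset.disjoint_left]
        intro x hx hxY
        obtain ⟨y, hy, h⟩ := hY x hxY
        exact h01 x hx y hy h)
    have e4 := Z.μ_indep (L 0) h00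
    rw [hX]
    have f1 := mul_le_mul_of_nonneg_left (show ∑ x ∈ L 2, Z.μ x ≤
      1 - (χ - 1) * ∑ x ∈ A₁, Z.μ x - ∑ x ∈ Y, Z.μ x by linarith) hχ0
    have f2 := mul_le_mul_of_nonneg_left e3 (show 0 ≤ (χ - 2) * χ by nlinarith)
    nlinarith

end FractionalCertificate

namespace FractionalCertificate

open Classical in
/-- The generalized Mycielskian increases the fractional chromatic number. -/
noncomputable def step {χ : ℝ} (hχ : 2 ≤ χ) (Z : FractionalCertificate χ) :
    FractionalCertificate (χ + 1 / (1 + (χ - 1) + (χ - 1) ^ 2)) :=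
  let D : ℝ := 1 + (χ - 1) + (χ - 1) ^ 2
  let T : ℝ := χ * D + 1
  have hD : 1 ≤ D := by simp only [D]; nlinarith
  have hT : 0 < T := by simp only [T]; nlinarith
  have hTD : χ + 1 / D = T / D := by
    simp only [T]; field_simp
  { V := Option (Z.V × Fin 3)
    G := mycielskian Z.G
    noFive := Z.noFive.mycielskian
    μ := fun x => (match x with
      | none => 1
      | some z => (χ - 1) ^ (2 - z.2.1) * χ * Z.μ z.1 : ℝ) / T
    μ_nonneg := by
      rintro (_ | ⟨x, i⟩)
      · positivity
      · have := Z.μ_nonneg x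
        have : 0 ≤ χ - 1 := by linarith
        have : 0 ≤ χ := by linarith
        positivity
    μ_total := by
      rw [← Finset.sum_div, div_eq_one_iff_eq hT.ne']
      simp only [Fintype.sum_option, Fintype.sum_prod_type, Fin.sum_univ_three,
        Finset.sum_add_distrib, ← Finset.mul_sum, Z.μ_total]
      simp [T, D]
      ring
    μ_indep := by
      intro A hA
      have h := Z.mycielskian_weight_le hχ A hA
      change (χ + 1 / D) * _ ≤ 1
      rw [← Finset.sum_div, hTD, div_mul_div_comm, mul_comm D T, mul_div_mul_left _ _ hT.ne',
        div_le_one (by linarith)]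
      exact h
    ι := Option (Z.ι × Fin 3)
    -- Masses for the four types of independent set in `J`, chosen so that they total `T` and cover
    -- every vertex with at least `D`; the ratio `T / D` is the new value.
    ν := fun j => (match j with
      | none => 1
      | some (j, 0) => (D - 1) * Z.ν j
      | some (j, 1) => (χ - 1) * (D - 1) * Z.ν j
      | some (j, 2) => χ * Z.ν j : ℝ) / T
    ν_nonneg := by
      have : 0 ≤ D - 1 := by linarith
      have : 0 ≤ χ - 1 := by linarith
      have : 0 ≤ χ := by linarith
      rintro (_ | ⟨j, i⟩)
      · positivity
      · have := Z.ν_nonneg j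
        fin_cases i <;> simp only [] <;> positivity
    ν_total := by
      rw [← Finset.sum_div, div_eq_one_iff_eq hT.ne']
      simp only [Fintype.sum_option, Fintype.sum_prod_type, Fin.sum_univ_three,
        Finset.sum_add_distrib, ← Finset.mul_sum, Z.ν_total]
      simp only [T]
      ring
    J := fun j x => match j, x with
      | none, none => True
      | none, some x => x.2 = 1
      | some (_, 0), none => True
      | some (j, 0), some x => x.2 ≠ 2 ∧ Z.J j x.1
      | some (_, 1), none => False
      | some (j, 1), some x => Z.J j x.1
      | some (_, 2), none => False
      | some (j, 2), some x => x.2 = 2 ∨ (x.2 = 0 ∧ Z.J j x.1)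
    J_indep := by
      rintro (_ | ⟨j, i⟩) (_ | ⟨x, k⟩) (_ | ⟨y, l⟩) hx hy h
      · exact h
      · simp_all [mycielskian]
      · simp_all [mycielskian]
      · simp_all [mycielskian]
      · exact h
      · fin_cases i <;> simp_all [mycielskian]
      · fin_cases i <;> simp_all [mycielskian]
      · have h1 := Z.J_indep j x y
        have h2 := h.1
        have h3 := h.2
        fin_cases i
        · exact h1 hx.2 hy.2 h2
        · exact h1 hx hy h2
        · simp_all
          rcases hx with hx | hx <;> rcases hy with hy | hy <;> simp_all
    cover := by
      intro x
      have hdiv : ∀ (p : Option (Z.ι × Fin 3) → Prop) (w : Option (Z.ι × Fin 3) → ℝ),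
          ∑ j, (if p j then w j / T else 0) = (∑ j, if p j then w j else 0) / T := by
        intro p w
        rw [Finset.sum_div]
        exact Finset.sum_congr rfl fun j _ => by split_ifs <;> simp
      have hsum : ∀ (p : Z.ι → Prop) (c : ℝ), ∑ j, (if p j then c * Z.ν j else 0) =
          c * (∑ j, if p j then Z.ν j else 0) := by
        intro p c
        rw [Finset.mul_sum]
        exact Finset.sum_congr rfl fun j _ => by split_ifs <;> simp
      have hfin : ∀ w : ℝ, D ≤ w → 1 ≤ T / D * (w / T) := by
        intro w hw
        rw [div_mul_div_comm, mul_comm D T, mul_div_mul_left _ _ hT.ne', one_le_div (by linarith)]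
        exact hw
      change _ ≤ (χ + 1 / D) * _
      rw [hTD, hdiv]
      refine hfin _ ?_
      rw [Fintype.sum_option, Fintype.sum_prod_type]
      simp only [Fin.sum_univ_three, Finset.sum_add_distrib]
      have hν := Z.ν_total
      have hr : 0 ≤ χ - 1 := by linarith
      have hD1 : D - 1 = (χ - 1) * χ := by simp only [D]; ring
      rcases x with _ | ⟨x, k⟩
      · simp [← Finset.mul_sum, hν]
      · have hc := Z.cover x
        fin_cases k
        · simp [hsum]
          nlinarith
        · simp [hsum]
          nlinarith
        · simp [hsum, ← Finset.mul_sum, hν]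
          have := mul_le_mul_of_nonneg_left hc (sq_nonneg (χ - 1))
          rw [hD1]
          simp only [D]
          nlinarith }

/-- While `χ < F`, each `step` adds at least the fixed amount `1 / (1 + F + F ^ 2)`. -/
theorem exists_le (F : ℝ) : ∃ χ : ℝ, F ≤ χ ∧ Nonempty (FractionalCertificate χ) := by
  by_contra! hcon
  have key : ∀ k : ℕ, ∃ χ : ℝ, 2 ≤ χ ∧ 2 + k * (1 / (1 + F + F ^ 2)) ≤ χ ∧
      Nonempty (FractionalCertificate χ) := by
    intro k
    induction k with
    | zero => exact ⟨2, le_rfl, by simp, ⟨edge⟩⟩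
    | succ k ih =>
      obtain ⟨χ, h2, hk, ⟨Z⟩⟩ := ih
      have hF : χ < F := by
        by_contra! h
        exact (hcon χ h).false Z
      have h1 : 1 / (1 + F + F ^ 2) ≤ 1 / (1 + (χ - 1) + (χ - 1) ^ 2) :=
        one_div_le_one_div_of_le (by nlinarith) (by nlinarith)
      have h0 : 0 < 1 / (1 + F + F ^ 2) := one_div_pos.2 (by nlinarith)
      refine ⟨_, ?_, ?_, ⟨Z.step h2⟩⟩
      · linarith
      · push_cast
        linarith
  have hD : 0 < 1 + F + F ^ 2 := by nlinarith [sq_nonneg (F + 1)]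
  obtain ⟨k, hk⟩ := exists_nat_ge (F * (1 + F + F ^ 2))
  obtain ⟨χ, -, h, hZ⟩ := key k
  refine (not_nonempty_iff.2 (hcon χ ?_)) hZ
  have : F ≤ k * (1 / (1 + F + F ^ 2)) := by
    rw [mul_one_div, le_div_iff₀ hD]
    exact hk
  linarith

/-- The chromatic number of `G[K_q]` is at least `q` times the fractional one of `G`. -/
theorem mul_le_of_colorable {χ : ℝ} (Z : FractionalCertificate χ) {q N : ℕ}
    (h : (cliqueBlowup Z.G q).Colorable N) : χ * q ≤ N := by
  classical
  obtain ⟨c⟩ := h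
  let A : Fin N → Finset Z.V := fun a => Finset.univ.filter fun x => ∃ i, c (x, i) = a
  have hA : ∀ a, χ * ∑ x ∈ A a, Z.μ x ≤ 1 := by
    refine fun a => Z.μ_indep _ fun x hx y hy hxy => ?_
    obtain ⟨i, hi⟩ := (Finset.mem_filter.1 hx).2
    obtain ⟨j, hj⟩ := (Finset.mem_filter.1 hy).2
    exact c.valid (v := (x, i)) (w := (y, j)) (Or.inl hxy) (hi.trans hj.symm)
  -- The `q` copies of `x` form a clique, so `x` lies in exactly `q` of the sets `A a`.
  have hcount : ∀ x, ∑ a, (if x ∈ A a then Z.μ x else 0) = q * Z.μ x := by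
    intro x
    have : (Finset.univ.filter fun a => x ∈ A a) = Finset.univ.image fun i => c (x, i) := by
      ext a; simp [A]
    rw [← Finset.sum_filter, Finset.sum_const, this, Finset.card_image_of_injective]
    · simp
    · intro i j hij
      by_contra hne
      exact c.valid (v := (x, i)) (w := (x, j)) (Or.inr ⟨rfl, hne⟩) hij
  have htot : ∑ a, ∑ x ∈ A a, Z.μ x = q := by
    have : ∀ a, ∑ x ∈ A a, Z.μ x = ∑ x, if x ∈ A a then Z.μ x else 0 := by
      intro a; rw [Finset.sum_ite_mem, Finset.univ_inter]
    simp only [this]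
    rw [Finset.sum_comm]
    simp only [hcount, ← Finset.mul_sum, Z.μ_total, mul_one]
  calc χ * q = ∑ a, χ * ∑ x ∈ A a, Z.μ x := by rw [← Finset.mul_sum, htot]
    _ ≤ ∑ _a : Fin N, (1 : ℝ) := Finset.sum_le_sum fun a _ => hA a
    _ = N := by simp

end FractionalCertificate


/-! ### Homomorphisms between Kneser graphs -/

/-- A colouring of `K_m ^ Γ` assigns to each `n`-set `S` of colours the set of colours that it
uses on the maps into `S`. -/
theorem exists_hom_kneserGraph {W : Type*} [Finite W] {Γ : SimpleGraph W} {m n N : ℕ}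
    (hΓ : ¬ Γ.Colorable m)
    (hn : ∀ S : Finset (Fin m), S.card = n → ¬ (expGraph S Γ).Colorable n)
    (hN : (expGraph (Fin m) Γ).Colorable N) :
    Nonempty (kneserGraph m n →g kneserGraph N (n + 1)) := by
  classical
  have := Fintype.ofFinite W
  obtain ⟨Ψ⟩ := hN
  let K : Finset (Fin m) → Finset (Fin N) := fun S =>
    Finset.univ.image fun f : W → S => Ψ fun x => (f x : Fin m)
  have hK : ∀ S : {S : Finset (Fin m) // S.card = n}, n + 1 ≤ (K S.1).card := by
    rintro ⟨S, hS⟩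
    by_contra! hlt
    refine hn S hS ?_
    let c : (expGraph S Γ).Coloring (K S) := SimpleGraph.Coloring.mk
      (fun f => ⟨Ψ fun x => (f x : Fin m), Finset.mem_image_of_mem _ (Finset.mem_univ f)⟩) (by
        intro f g hfg h
        refine Ψ.valid (v := fun x => (f x : Fin m)) (w := fun x => (g x : Fin m))
          ⟨?_, ?_⟩ (congrArg Subtype.val h)
        · exact fun h => hfg.1 (funext fun x => Subtype.ext (congrFun h x))
        · exact fun x y hxy h => hfg.2 x y hxy (Subtype.ext h))
    exact c.colorable.mono (by simpa using Nat.lt_succ_iff.1 hlt)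
  choose k hkK hk using fun S => Finset.exists_subset_card_eq (hK S)
  refine ⟨⟨fun S => ⟨k S, hk S⟩, ?_⟩⟩
  rintro S T ⟨-, hST⟩
  -- Maps into disjoint sets are adjacent, so they cannot share a colour.
  have hd : Disjoint (k S) (k T) := by
    rw [Finset.disjoint_left]
    intro a hS hT
    obtain ⟨f, -, hf⟩ := Finset.mem_image.1 (hkK S hS)
    obtain ⟨g, -, hg⟩ := Finset.mem_image.1 (hkK T hT)
    refine Ψ.valid (expGraph_adj_of_isEmpty ⟨fun c => hΓ (by simpa using c.colorable)⟩
      fun x y _ h => ?_) (hf.trans hg.symm)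
    exact Finset.disjoint_left.1 hST (f x).2 (h ▸ (g y).2)
  refine ⟨fun h => ?_, hd⟩
  have h' : k S = k T := congrArg Subtype.val h
  rw [← h', disjoint_self] at hd
  have := hk S
  rw [hd] at this
  simp at this

/-- Fractional chromatic numbers of Kneser graphs are monotone under homomorphisms. -/
theorem mul_le_of_hom_kneserGraph {m n N l : ℕ} (hn : 0 < n) (hm : 2 * n ≤ m)
    (f : kneserGraph m n →g kneserGraph N l) : l * m ≤ N * n := by
  classical
  -- Each `A a` is the preimage of a star, hence an intersecting family; Erdős–Ko–Rado bounds it,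
  -- and the incidences are counted twice.
  let A : Fin N → Finset {S : Finset (Fin m) // S.card = n} := fun a =>
    Finset.univ.filter fun S => a ∈ (f S).1
  have hA : ∀ a, (A a).card ≤ (m - 1).choose (n - 1) := by
    intro a
    rw [← Finset.card_map (Function.Embedding.subtype _)]
    apply Finset.erdos_ko_rado
    · intro S hS T hT hST
      simp only [Finset.coe_map, Set.mem_image, Finset.mem_coe] at hS hT
      obtain ⟨S, hS, rfl⟩ := hS
      obtain ⟨T, hT, rfl⟩ := hT
      have hS' : a ∈ (f S).1 := by simpa [A] using hS
      have hT' : a ∈ (f T).1 := by simpa [A] using hT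
      have hne : S ≠ T := by
        rintro rfl
        have h1 : S.1 = ∅ := by simpa using hST
        have h2 := S.2
        rw [h1] at h2
        simp at h2
        omega
      exact Finset.disjoint_left.1 (f.map_rel (show (kneserGraph m n).Adj S T from ⟨hne, hST⟩)).2
        hS' hT'
    · intro S hS
      simp only [Finset.coe_map, Set.mem_image, Finset.mem_coe] at hS
      obtain ⟨S, -, rfl⟩ := hS
      exact S.2
    · omega
  have h1 : ∑ a, (A a).card = m.choose n * l := by
    simp only [A, Finset.card_filter]
    rw [Finset.sum_comm]
    simp only [← Finset.card_filter, Finset.filter_univ_mem, (f _).2]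
    simp
  have h2 : m.choose n * l ≤ N * (m - 1).choose (n - 1) := by
    rw [← h1]
    refine (Finset.sum_le_card_nsmul _ _ _ fun a _ => hA a).trans ?_
    simp
  have h3 : m * (m - 1).choose (n - 1) = m.choose n * n := by
    obtain ⟨m, rfl⟩ : ∃ k, m = k + 1 := ⟨m - 1, by omega⟩
    obtain ⟨n, rfl⟩ : ∃ k, n = k + 1 := ⟨n - 1, by omega⟩
    exact Nat.add_one_mul_choose_eq m n
  have h4 : 0 < (m - 1).choose (n - 1) := Nat.choose_pos (by omega)
  refine Nat.le_of_mul_le_mul_right ?_ h4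
  calc l * m * (m - 1).choose (n - 1) = m.choose n * l * n := by rw [mul_assoc, h3]; ring
    _ ≤ N * (m - 1).choose (n - 1) * n := Nat.mul_le_mul_right _ h2
    _ = N * n * (m - 1).choose (n - 1) := by ring

theorem StahlConjecture.le_of_hom (h : StahlConjecture) {m n N : ℕ} (hn : 2 ≤ n) (hm : 2 * n ≤ m)
    (f : kneserGraph m n →g kneserGraph N (n + 1)) : 2 * m - 2 * (n - 1) ≤ N := by
  have h1 := h m n 1 1 (n + 1) (by ring) le_rfl le_rfl (by omega) hm
  have h2 : multichromaticNumber (kneserGraph m n) (n + 1) ≤ N := iInf₂_le N ⟨f⟩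
  rw [h1.1, h1.2] at h2
  exact_mod_cast h2

/-! ### Bounds for the Poljak–Rödl function -/

/-- Evaluation colours `Γ × K_m ^ Γ` with `m` colours. -/
theorem poljakRodl_le_of_expGraph {W : Type} [Finite W] {Γ : SimpleGraph W} {m n : ℕ}
    (h1 : (n : ℕ∞) ≤ Γ.chromaticNumber) (h2 : (n : ℕ∞) ≤ (expGraph (Fin m) Γ).chromaticNumber) :
    poljakRodl n ≤ m := by
  have hc : (catProd Γ (expGraph (Fin m) Γ)).Colorable m :=
    ⟨SimpleGraph.Coloring.mk (fun z => z.2 z.1) fun {a b} hab => hab.2.2 a.1 b.1 hab.1⟩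
  obtain ⟨k, hk⟩ := ENat.ne_top_iff_exists.1
    (SimpleGraph.chromaticNumber_ne_top_iff_exists.2 ⟨m, hc⟩)
  have hkm : k ≤ m := by
    have := hc.chromaticNumber_le
    rw [← hk] at this
    exact_mod_cast this
  refine le_trans (Nat.sInf_le ?_) hkm
  exact ⟨W, W → Fin m, inferInstance, inferInstance, Γ, expGraph (Fin m) Γ, h1, h2,
    hk.symm⟩

theorem FractionalCertificate.poljakRodl_le {χ : ℝ} (Z : FractionalCertificate χ)
    {q m n : ℕ} (hq : Fintype.card Z.V ^ 3 < 4 * q + 2) (hmn : m < n) (hn : n ≤ χ * q)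
    (hN : ∀ N, Nonempty (kneserGraph m (4 * q + 2) →g kneserGraph N (4 * q + 2 + 1)) → n ≤ N) :
    poljakRodl n ≤ m := by
  have hcol : ∀ N, (cliqueBlowup Z.G q).Colorable N → n ≤ N := fun N h => by
    exact_mod_cast hn.trans (Z.mul_le_of_colorable h)
  have hΓ : ¬ (cliqueBlowup Z.G q).Colorable m := fun h => by
    have := hcol m h
    omega
  refine poljakRodl_le_of_expGraph (Γ := cliqueBlowup Z.G q)
    (SimpleGraph.le_chromaticNumber_iff_colorable.2 hcol) ?_
  refine SimpleGraph.le_chromaticNumber_iff_colorable.2 fun N h => hN N ?_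
  refine exists_hom_kneserGraph hΓ (fun S hS => ?_) h
  have hcard : Fintype.card S = 4 * q + 2 := by simpa using hS
  have hSm : Fintype.card S ≤ m := by simpa using S.card_le_univ
  have hemp := not_colorable_expGraph (C := S) Z.noFive
    ⟨fun c => hΓ (c.colorable.mono hSm)⟩ (hcard ▸ hq) hcard.ge
  intro hc
  exact hemp.false (hc.toColoring hcard.ge)

theorem eventually_poljakRodl_add_le (C : ℕ) : ∀ᶠ n in Filter.atTop, poljakRodl n + C ≤ n := by
  wlog hC : 2 ≤ C
  · filter_upwards [this 2 le_rfl] with n hn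
    omega
  obtain ⟨χ, hχ, ⟨Z⟩⟩ := FractionalCertificate.exists_le (16 * C)
  filter_upwards [Filter.eventually_ge_atTop (16 * C * (Fintype.card Z.V ^ 3 + 1))] with n hn
  obtain ⟨q, hq1, hq2⟩ : ∃ q, 8 * C * q ≤ n ∧ n < 8 * C * (q + 1) :=
    ⟨n / (8 * C), Nat.mul_div_le _ _, Nat.lt_mul_div_succ _ (by omega)⟩
  have hn16 : 16 * C ≤ n := le_trans (Nat.le_mul_of_pos_right _ (by omega)) hn
  have hqV : Fintype.card Z.V ^ 3 < 4 * q + 2 := by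
    have : 8 * C * (2 * (Fintype.card Z.V ^ 3 + 1)) < 8 * C * (q + 1) := by linarith
    have := Nat.lt_of_mul_lt_mul_left this
    omega
  have hnq : n ≤ 16 * C * q := by nlinarith
  -- With `m = n - C` this says `m / (4q + 2) ≥ C`, so `N ≥ m + m / (4q + 2)` yields `N ≥ n`.
  have hCm : C * (4 * q + 2) ≤ n - C := by
    have : C * (4 * q + 2) + C ≤ n := by linarith
    omega
  have h := Z.poljakRodl_le (q := q) (m := n - C) (n := n) hqV (by omega)
    (by
      calc (n : ℝ) ≤ 16 * C * q := by exact_mod_cast hnq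
        _ ≤ χ * q := by gcongr)
    (fun N ⟨f⟩ => by
      have h1 := mul_le_of_hom_kneserGraph (by omega)
        (le_trans (Nat.mul_le_mul_right _ hC) hCm) f
      refine Nat.le_of_mul_le_mul_right (c := 4 * q + 2) ?_ (by omega)
      have h2 : n = (n - C) + C := by omega
      rw [h2]
      linarith)
  omega

theorem StahlConjecture.eventually_poljakRodl_le (h : StahlConjecture) {k : ℕ} (hk : 0 < k) :
    ∀ᶠ n : ℕ in Filter.atTop, (poljakRodl n : ℝ) / n ≤ 1 / 2 + 1 / k := by
  obtain ⟨χ, hχ, ⟨Z⟩⟩ := FractionalCertificate.exists_le (32 * k)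
  filter_upwards [Filter.eventually_ge_atTop (32 * k * (Fintype.card Z.V ^ 3 + 1))] with n hn
  obtain ⟨q, hq1, hq2⟩ : ∃ q, 16 * k * q ≤ n ∧ n < 16 * k * (q + 1) :=
    ⟨n / (16 * k), Nat.mul_div_le _ _, Nat.lt_mul_div_succ _ (by omega)⟩
  have hn32 : 32 * k ≤ n := le_trans (Nat.le_mul_of_pos_right _ (by omega)) hn
  have hqV : Fintype.card Z.V ^ 3 < 4 * q + 2 := by
    have : 16 * k * (2 * (Fintype.card Z.V ^ 3 + 1)) < 16 * k * (q + 1) := by linarith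
    have := Nat.lt_of_mul_lt_mul_left this
    omega
  have hnq : n ≤ 32 * k * q := by nlinarith
  have hkq : 16 * q ≤ n := le_trans (Nat.mul_le_mul_right _ (by omega)) hq1
  -- Here `2m - 2(4q + 1) = 2⌊n/2⌋ + 2 ≥ n`, and the excess `4q + 2` of `m` over `n/2` is at most
  -- `n/(2k)`.
  have hle := Z.poljakRodl_le (q := q) (m := n / 2 + 4 * q + 2) (n := n) hqV (by omega)
    (by
      calc (n : ℝ) ≤ 32 * k * q := by exact_mod_cast hnq
        _ ≤ χ * q := by gcongr)
    (fun N ⟨f⟩ => by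
      have := h.le_of_hom (by omega) (by omega) f
      omega)
  have hn0 : (0 : ℝ) < n := by
    have : 0 < n := by omega
    exact_mod_cast this
  have hk0 : (0 : ℝ) < k := by exact_mod_cast hk
  rw [div_le_iff₀ hn0]
  have h1 : 2 * poljakRodl n ≤ n + 8 * q + 4 := by omega
  have h1' : (2 * poljakRodl n : ℝ) ≤ n + 8 * q + 4 := by exact_mod_cast h1
  have h2 : k * (8 * q + 4) ≤ n := by linarith
  have h2' : (8 * q + 4 : ℝ) ≤ n / k := by
    rw [le_div_iff₀ hk0, mul_comm]
    exact_mod_cast h2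
  have h3 : (1 / 2 + 1 / (k : ℝ)) * n = n / 2 + n / k := by ring
  have h4 : (0 : ℝ) ≤ n / k := by positivity
  linarith

theorem proposition1 :
    Filter.Tendsto (fun n : ℕ => (n : ℤ) - (poljakRodl n : ℤ)) Filter.atTop Filter.atTop ∧
    (StahlConjecture →
      Filter.limsup (fun n : ℕ => (((poljakRodl n : ℝ) / (n : ℝ) : ℝ) : EReal)) Filter.atTop
        ≤ ((1 / 2 : ℝ) : EReal)) := by
  refine ⟨Filter.tendsto_atTop.2 fun b => ?_, fun h => ?_⟩
  · filter_upwards [eventually_poljakRodl_add_le b.toNat] with n hn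
    omega
  · refine EReal.le_of_forall_lt_iff_le.1 fun z hz => ?_
    have hz' : (1 / 2 : ℝ) < z := by exact_mod_cast hz
    obtain ⟨k, hk⟩ := exists_nat_one_div_lt (sub_pos.2 hz')
    refine Filter.limsup_le_of_le (by isBoundedDefault) ?_
    filter_upwards [h.eventually_poljakRodl_le k.succ_pos] with n hn
    refine EReal.coe_le_coe_iff.2 (hn.trans ?_)
    push_cast
    linarith
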